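/- For a finite graph $G$ and a perfect matching $M$ of $G$, a forcing set of $M$ is a set $S\subseteq M$ contained in no other perfect matching of $G$; $f(G,M)$ is the least cardinality of a forcing set of $M$, and the forcing polynomial of $G$ is $F(G,x)=\sum_M x^{f(G,M)}$, the sum being over all perfect matchings $M$ of $G$. Tile the plane by regular hexagons $C_{i,j}$ ($i,j\in\mathbb Z$) of side $\frac{\sqrt3}{3}$ with two vertical edges, the centre of $C_{i,j}$ being $(i-1)a+(j-1)b$ with $b=(-1,0)$ and $a=\left(-\frac12,-\frac{\sqrt3}{2}\right)$; so $C_{i,j+1}$ is the left neighbour and $C_{i+1,j}$ the lower left neighbour of $C_{i,j}$. For integers $b_1,\dots,b_m,d_1,\dots,d_m$ let $CHS(\{b_s;d_s\}_{s=1}^m)$ be the graph formed by the vertices and edges of all hexagons $C_{i,j}$ with $1\le i\le m$ and $d_i\le j\le b_i$, and let $F(\{b_s;d_s\}_{s=1}^m)$ be its forcing polynomial. **Theorem.** Let $m\ge1$ and let $k_1,\dots,k_m,h_1,\dots,h_m$ be integers with $k_i\le k_{i+1}$ and $h_i\le h_{i+1}$ for $1\le i\le m-1$ and $h_j\le k_j$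 for $1\le j\le m$. Put $p=\min\{s: 1\le s\le m,\ k_s=k_m\}$. Then $$F(\{k_s;h_s\}_{s=1}^m)=\sum_{i=h_m-1}^{k_m-1}F(\{\min\{k_s,i\};h_s\}_{s=1}^{m-1})\,x+\sum_{j=p}^{m}F(\{\min\{k_s,k_m-1\};h_s\}_{s=1}^{j-1})\,x .$$ Moreover, for arbitrary integers, $F(\{b_s;d_s\}_{s=1}^i)=F(\{b_s;d_s\}_{s=1}^{i-1})$ whenever $i\ge1$ and $b_i<d_i$, and $F(\{b_s;d_s\}_{s=1}^{0})=1$. -/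

import Mathlib

open Polynomial

/-! ### Forcing numbers and the forcing polynomial of a finite graph -/

/-- A finite set `S` of edges is a forcing set of the perfect matching `M` of `G` if `S ⊆ M` and no
other perfect matching of `G` contains `S`. -/
def IsForcingSet {V : Type*} (G : SimpleGraph V) (M : G.Subgraph) (S : Finset (Sym2 V)) : Prop :=
  (S : Set (Sym2 V)) ⊆ M.edgeSet ∧
    ∀ M' : G.Subgraph, M'.IsPerfectMatching → (S : Set (Sym2 V)) ⊆ M'.edgeSet → M' = M

/-- The forcing number `f(G, M)`: the least cardinality of a forcing set of `M`. (In a finite graph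
`M` itself is a forcing set, so the minimum is over a nonempty set.) -/
noncomputable def forcingNumber {V : Type*} (G : SimpleGraph V) (M : G.Subgraph) : ℕ :=
  sInf {n : ℕ | ∃ S : Finset (Sym2 V), IsForcingSet G M S ∧ S.card = n}

/-- The forcing polynomial `F(G, x) = ∑ x ^ f(G, M)`, the sum being over all perfect matchings `M`
of the finite graph `G`. -/
noncomputable def forcingPolynomial {V : Type*} [Finite V] (G : SimpleGraph V) : ℤ[X] :=
  ∑ M ∈ (Set.toFinite {M : G.Subgraph | M.IsPerfectMatching}).toFinset, X ^ forcingNumber G M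

/-! ### The hexagonal lattice

The hexagons `C i j` (`i j : ℤ`) are the regular hexagons of side `√3 / 3`, with two vertical edges,
tiling the plane; the centre of `C i j` is `(i - 1) • a + (j - 1) • b`, where `b = (-1, 0)` points
to the left and `a = (-1/2, -√3/2)` points to the lower left. Hence `C i (j+1)` and `C i (j-1)` are
the left and right neighbours of `C i j`, `C (i+1) j` and `C (i+1) (j-1)` its lower left and lower
right neighbours, and `C (i-1) (j+1)` and `C (i-1) j` its upper left and upper right neighbours.
Every vertex of the tiling is the topmost vertex of exactly one hexagon or the bottommost vertex of
exactly one hexagon, but not both. -/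

/-- The vertices of the hexagonal lattice. -/
inductive HexVertex : Type
  /-- the topmost vertex of the hexagon `C i j` -/
  | top (i j : ℤ) : HexVertex
  /-- the bottommost vertex of the hexagon `C i j` -/
  | bot (i j : ℤ) : HexVertex

namespace HexVertex

/-- The left vertical edge `e_{i,j}` of `C i j`. Its upper end is the bottommost vertex of the upper
left neighbour, its lower end the topmost vertex of the lower left neighbour. -/
def edgeE (i j : ℤ) : Sym2 HexVertex := s(bot (i - 1) (j + 1), top (i + 1) j)

/-- The top left oblique edge `l_{i,j}` of `C i j`. -/
def edgeL (i j : ℤ) : Sym2 HexVertex := s(top i j, bot (i - 1) (j + 1))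

/-- The top right oblique edge `r_{i,j}` of `C i j`. -/
def edgeR (i j : ℤ) : Sym2 HexVertex := s(top i j, bot (i - 1) j)

/-- The six edges of the hexagon `C i j`: left vertical, top left oblique, top right oblique,
right vertical, bottom right oblique, bottom left oblique. -/
def hexEdges (i j : ℤ) : Set (Sym2 HexVertex) :=
  {edgeE i j, edgeL i j, edgeR i j, edgeE i (j - 1), edgeL (i + 1) (j - 1), edgeR (i + 1) j}

end HexVertex

/-! ### The systems `CHS({k_s; h_s}_{s=1}^m)` -/

/-- The edges of `CHS({k_s; h_s}_{s=1}^m)`: all edges of the hexagons `C i j` with `1 ≤ i ≤ m` and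
`h_i ≤ j ≤ k_i`. (A row with `k_i < h_i` contains no hexagon.) -/
def chsEdges (m : ℕ) (k h : ℕ → ℤ) : Set (Sym2 HexVertex) :=
  {e | ∃ i : ℕ, ∃ j : ℤ, 1 ≤ i ∧ i ≤ m ∧ h i ≤ j ∧ j ≤ k i ∧ e ∈ HexVertex.hexEdges (i : ℤ) j}

/-- The vertices of `CHS({k_s; h_s}_{s=1}^m)`: all vertices of its hexagons. -/
def chsVerts (m : ℕ) (k h : ℕ → ℤ) : Set HexVertex :=
  {v | ∃ e ∈ chsEdges m k h, v ∈ e}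

/-- The graph `CHS({k_s; h_s}_{s=1}^m)`, whose `i`-th row consists of the hexagons
`C i (h i), …, C i (k i)`. Its edges are exactly the edges of its hexagons. Only the values of `k`
and `h` at `1, …, m` matter. For `m = 0` it is the empty graph. -/
def chs (m : ℕ) (k h : ℕ → ℤ) : SimpleGraph (chsVerts m k h) :=
  (SimpleGraph.fromEdgeSet (chsEdges m k h)).induce (chsVerts m k h)

theorem chsEdges_finite (m : ℕ) (k h : ℕ → ℤ) : (chsEdges m k h).Finite := by
  have hfin : (⋃ i ∈ Set.Icc 1 m, ⋃ j ∈ Set.Icc (h i) (k i),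
      HexVertex.hexEdges (i : ℤ) j).Finite := by
    refine (Set.finite_Icc 1 m).biUnion fun i _ => (Set.finite_Icc (h i) (k i)).biUnion fun j _ => ?_
    unfold HexVertex.hexEdges
    exact Set.toFinite _
  refine hfin.subset ?_
  rintro e ⟨i, j, hi1, him, hj1, hjk, he⟩
  simp only [Set.mem_iUnion]
  exact ⟨i, ⟨hi1, him⟩, j, ⟨hj1, hjk⟩, he⟩

instance chsVerts_finite (m : ℕ) (k h : ℕ → ℤ) : Finite (chsVerts m k h) := by
  have hfin : (⋃ e ∈ chsEdges m k h, {v | v ∈ e}).Finite := by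
    refine (chsEdges_finite m k h).biUnion fun e _ => ?_
    induction e using Sym2.ind with
    | _ a b =>
      refine (Set.toFinite ({a, b} : Set HexVertex)).subset ?_
      intro v hv
      simpa using hv
  refine (hfin.subset ?_).to_subtype
  rintro v ⟨e, he, hv⟩
  simp only [Set.mem_iUnion]
  exact ⟨e, he, hv⟩

/-- `F({k_s; h_s}_{s=1}^m)`, the forcing polynomial of `CHS({k_s; h_s}_{s=1}^m)`. -/
noncomputable def chsForcingPoly (m : ℕ) (k h : ℕ → ℤ) : ℤ[X] :=
  forcingPolynomial (chs m k h)

/-!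
The perfect matchings of `CHS({k_s; h_s})` are the lattice paths `v 1 ≤ v 2 ≤ ⋯ ≤ v m` with
`h i - 1 ≤ v i ≤ k i`: exactly one vertical edge `e_{i, v i}` of each row `i` is matched, the zigzag
between two rows is then matched in a unique way, and this is possible exactly if `v (i-1) ≤ v i`.
The edge `r_{i,j}` is matched if and only if `v (i-1) < j ≤ v i`, and `l_{i,j}` if and only if
`j < v (i-1)` or `v i < j` (`exists_path`, `pathMatching_mem`). To treat all rows alike, the rows are
indexed by `ℤ`, with empty rows above row `1` and below row `m`, in which a path has only one
choice.

The recursion sorts the matchings by one edge they contain. If `v m = i < k m`, the matching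
contains `e_{m,i}`. If `v m = k m`, let `j` be the first row with `v j = k m`; then `k j = k m`,
so `p ≤ j`, and the matching contains `r_{j, k m}`. Fixing such an edge fixes `v` from row `m`,
respectively `j`, on, and what is left is an arbitrary path of the smaller system obtained by
cutting off those rows and the columns beyond `i`, respectively `k m - 1`. The remaining matched
edges do not depend on the path.

The forcing number drops by exactly one in this process (`familyForcingNumber_union`). A forcing
set of the smaller matching together with the fixed edge is a forcing set of the larger one.
Conversely, the hexagon `C m (i+1)`, respectively `C j (k m)`, is alternating, and its matched
edges lie outside the smaller system. A forcing set of the larger matching contains one of them,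
since otherwise it would also lie in the matching flipped along that hexagon, and its edges inside
the smaller system form a forcing set there.
-/

/-! ### Forcing in families of sets -/

/-- The least cardinality of a finite subset of `M` contained in no other member of the family
`𝓜`. For the family of (edge sets of) perfect matchings this is the forcing number. -/
noncomputable def familyForcingNumber {α : Type*} (𝓜 : Set (Set α)) (M : Set α) : ℕ :=
  sInf {n : ℕ | ∃ S : Finset α, (S : Set α) ⊆ M ∧ (∀ M' ∈ 𝓜, (S : Set α) ⊆ M' → M' = M) ∧
    S.card = n}

/-- The forcing polynomial `∑ x ^ f(M)` of a family of sets (a junk value if it is infinite). -/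
noncomputable def familyForcingPoly {α : Type*} (𝓜 : Set (Set α)) : ℤ[X] :=
  ∑ᶠ M ∈ 𝓜, X ^ familyForcingNumber 𝓜 M

theorem familyForcingNumber_image {α β : Type*} {g : α → β} (hg : Function.Injective g)
    (𝓜 : Set (Set α)) (M : Set α) :
    familyForcingNumber (Set.image g '' 𝓜) (g '' M) = familyForcingNumber 𝓜 M := by
  classical
  unfold familyForcingNumber
  congr 1
  ext n
  constructor
  · rintro ⟨S, hS, hF, rfl⟩
    have hSg : (S : Set β) ⊆ Set.range g := hS.trans (Set.image_subset_range _ _)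
    refine ⟨S.preimage g hg.injOn, ?_, ?_, ?_⟩
    · rw [Finset.coe_preimage]
      intro a ha
      exact (hg.mem_set_image).1 (hS ha)
    · intro M' hM' hSM'
      refine hg.image_injective (hF _ ⟨M', hM', rfl⟩ ?_)
      intro b hb
      obtain ⟨a, rfl⟩ := hSg hb
      exact ⟨a, hSM' (by simpa using hb), rfl⟩
    · rw [← Finset.card_image_of_injective _ hg, Finset.image_preimage]
      congr 1
      exact Finset.filter_true_of_mem fun b hb => hSg hb
  · rintro ⟨S, hS, hF, rfl⟩
    refine ⟨S.image g, ?_, ?_, Finset.card_image_of_injective _ hg⟩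
    · rw [Finset.coe_image]
      exact Set.image_mono hS
    · rintro _ ⟨M', hM', rfl⟩ hSM'
      rw [Finset.coe_image, Set.image_subset_image_iff hg] at hSM'
      rw [hF M' hM' hSM']

theorem familyForcingPoly_image {α β : Type*} {g : α → β} (hg : Function.Injective g)
    (𝓜 : Set (Set α)) :
    familyForcingPoly (Set.image g '' 𝓜) = familyForcingPoly 𝓜 := by
  unfold familyForcingPoly
  rw [finsum_mem_image hg.image_injective.injOn]
  simp_rw [familyForcingNumber_image hg]

/-- Adding a constant part `F` to the members of a family raises the forcing number by exactly one
if some element `e` of `F` picks out the enlarged members `X`, and some other member agrees with `X`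
outside `F`: such a member makes every forcing set of `X` meet `F`. -/
theorem familyForcingNumber_union {α : Type*} {𝓜 𝓜' : Set (Set α)} {F : Set α} {e : α}
    (heF : e ∈ F) (hdisj : ∀ Y ∈ 𝓜', Disjoint Y F)
    (hext : ∀ Y ∈ 𝓜', Y ∪ F ∈ 𝓜)
    (hres : ∀ X ∈ 𝓜, e ∈ X → ∃ Y ∈ 𝓜', X = Y ∪ F)
    {Y : Set α} (hY : Y ∈ 𝓜')
    (hfin : ∃ S : Finset α, (S : Set α) ⊆ Y ∧ ∀ Y' ∈ 𝓜', (S : Set α) ⊆ Y' → Y' = Y)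
    (hflip : ∃ N ∈ 𝓜, N ≠ Y ∪ F ∧ Y ⊆ N) :
    familyForcingNumber 𝓜 (Y ∪ F) = familyForcingNumber 𝓜' Y + 1 := by
  classical
  have upper : ∀ S : Finset α, (S : Set α) ⊆ Y → (∀ Y' ∈ 𝓜', (S : Set α) ⊆ Y' → Y' = Y) →
      ∃ T : Finset α, (T : Set α) ⊆ Y ∪ F ∧ (∀ M' ∈ 𝓜, (T : Set α) ⊆ M' → M' = Y ∪ F) ∧
        T.card = S.card + 1 := by
    intro S hS hF
    have heS : e ∉ S := fun h => (Set.disjoint_left.1 (hdisj Y hY)) (hS h) heF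
    refine ⟨insert e S, ?_, ?_, Finset.card_insert_of_notMem heS⟩
    · intro a ha
      rw [Finset.coe_insert] at ha
      rcases ha with rfl | ha
      · exact Or.inr heF
      · exact Or.inl (hS ha)
    · intro M' hM' hT
      rw [Finset.coe_insert, Set.insert_subset_iff] at hT
      obtain ⟨Y', hY', rfl⟩ := hres M' hM' hT.1
      rw [hF Y' hY' fun a ha => (hT.2 ha).resolve_right
        fun haF => (Set.disjoint_left.1 (hdisj Y hY)) (hS ha) haF]
  apply le_antisymm
  · have hne : {n : ℕ | ∃ S : Finset α, (S : Set α) ⊆ Y ∧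
        (∀ Y' ∈ 𝓜', (S : Set α) ⊆ Y' → Y' = Y) ∧ S.card = n}.Nonempty := by
      obtain ⟨S, h1, h2⟩ := hfin
      exact ⟨_, S, h1, h2, rfl⟩
    obtain ⟨S, h1, h2, h3⟩ := Nat.sInf_mem hne
    obtain ⟨T, t1, t2, t3⟩ := upper S h1 h2
    refine Nat.sInf_le ⟨T, t1, t2, ?_⟩
    rw [t3, h3]
    rfl
  · have hne : {n : ℕ | ∃ T : Finset α, (T : Set α) ⊆ Y ∪ F ∧
        (∀ M' ∈ 𝓜, (T : Set α) ⊆ M' → M' = Y ∪ F) ∧ T.card = n}.Nonempty := by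
      obtain ⟨S, h1, h2⟩ := hfin
      obtain ⟨T, t1, t2, -⟩ := upper S h1 h2
      exact ⟨_, T, t1, t2, rfl⟩
    obtain ⟨T, t1, t2, t3⟩ := Nat.sInf_mem hne
    obtain ⟨N, hN, hNne, hYN⟩ := hflip
    obtain ⟨a, haT, haN⟩ := Set.not_subset.1 fun h => hNne (t2 N hN h)
    have haF : a ∈ F := (t1 haT).resolve_left fun h => haN (hYN h)
    have hle : familyForcingNumber 𝓜' Y ≤ (T.filter (· ∉ F)).card := by
      refine Nat.sInf_le ⟨T.filter (· ∉ F), ?_, ?_, rfl⟩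
      · intro b hb
        rw [Finset.mem_coe, Finset.mem_filter] at hb
        exact (t1 hb.1).resolve_right hb.2
      · intro Y' hY' hS
        have hYF : Y' ∪ F = Y ∪ F := by
          refine t2 _ (hext Y' hY') fun b hb => ?_
          by_cases hbF : b ∈ F
          · exact Or.inr hbF
          · exact Or.inl (hS (by rw [Finset.mem_coe, Finset.mem_filter]; exact ⟨hb, hbF⟩))
        rw [← (hdisj Y' hY').sup_sdiff_cancel_right, ← (hdisj Y hY).sup_sdiff_cancel_right]
        exact congrArg (· \ F) hYF
    have hlt : (T.filter (· ∉ F)).card < T.card :=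
      Finset.card_lt_card (Finset.filter_ssubset.2 ⟨a, haT, by simpa using haF⟩)
    have : familyForcingNumber 𝓜 (Y ∪ F) = T.card := t3.symm
    omega

/-- Under the conditions of `familyForcingNumber_union`, the members containing `e` contribute `x`
times the forcing polynomial of the smaller family. -/
theorem finsum_forcing_mem {α : Type*} {𝓜 𝓜' : Set (Set α)} {F : Set α} {e : α}
    (heF : e ∈ F) (hdisj : ∀ Y ∈ 𝓜', Disjoint Y F)
    (hext : ∀ Y ∈ 𝓜', Y ∪ F ∈ 𝓜)
    (hres : ∀ X ∈ 𝓜, e ∈ X → ∃ Y ∈ 𝓜', X = Y ∪ F)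
    (hfin : ∀ Y ∈ 𝓜', ∃ S : Finset α, (S : Set α) ⊆ Y ∧ ∀ Y' ∈ 𝓜', (S : Set α) ⊆ Y' → Y' = Y)
    (hflip : ∀ Y ∈ 𝓜', ∃ N ∈ 𝓜, N ≠ Y ∪ F ∧ Y ⊆ N) :
    ∑ᶠ M ∈ {M ∈ 𝓜 | e ∈ M}, (X : ℤ[X]) ^ familyForcingNumber 𝓜 M =
      familyForcingPoly 𝓜' * X := by
  have himg : {M ∈ 𝓜 | e ∈ M} = (· ∪ F) '' 𝓜' := by
    ext M
    constructor
    · rintro ⟨hM, heM⟩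
      obtain ⟨Y, hY, rfl⟩ := hres M hM heM
      exact ⟨Y, hY, rfl⟩
    · rintro ⟨Y, hY, rfl⟩
      exact ⟨hext Y hY, Or.inr heF⟩
  have hinj : Set.InjOn (· ∪ F) 𝓜' := by
    intro Y hY Y' hY' h
    rw [← (hdisj Y' hY').sup_sdiff_cancel_right, ← (hdisj Y hY).sup_sdiff_cancel_right]
    exact congrArg (· \ F) h
  rw [himg, finsum_mem_image hinj]
  unfold familyForcingPoly
  rw [finsum_mem_mul]
  refine finsum_mem_congr rfl fun Y hY => ?_
  rw [familyForcingNumber_union heF hdisj hext hres hY (hfin Y hY) (hflip Y hY), pow_succ]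

/-! ### Perfect matchings as sets of edges -/

/-- The perfect matchings of the graph formed by the edges in `E` and their end vertices, as sets of
edges. -/
def perfectMatchings {V : Type*} (E : Set (Sym2 V)) : Set (Set (Sym2 V)) :=
  {X | X ⊆ E ∧ ∀ e ∈ E, ∀ u ∈ e, ∃! x, x ∈ X ∧ u ∈ x}

theorem forcingPolynomial_eq_family {V : Type*} [Finite V] (G : SimpleGraph V) :
    forcingPolynomial G =
      familyForcingPoly
        (SimpleGraph.Subgraph.edgeSet '' {M : G.Subgraph | M.IsPerfectMatching}) := by
  have hinj : Set.InjOn SimpleGraph.Subgraph.edgeSet {M : G.Subgraph | M.IsPerfectMatching} := by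
    intro M hM N hN h
    refine SimpleGraph.Subgraph.ext ?_ ?_
    · rw [SimpleGraph.Subgraph.isSpanning_iff.1 hM.2, SimpleGraph.Subgraph.isSpanning_iff.1 hN.2]
    · ext a b
      rw [← SimpleGraph.Subgraph.mem_edgeSet, h, SimpleGraph.Subgraph.mem_edgeSet]
  unfold familyForcingPoly forcingPolynomial
  rw [finsum_mem_image hinj, finsum_mem_eq_finite_toFinset_sum _ (Set.toFinite _)]
  refine Finset.sum_congr rfl fun M hM => ?_
  have hM' : M.IsPerfectMatching := by simpa using hM
  congr 1
  unfold forcingNumber familyForcingNumber IsForcingSet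
  congr 1
  ext n
  refine exists_congr fun S => ?_
  rw [and_assoc, Set.forall_mem_image]
  refine and_congr_right fun _ => and_congr_left fun _ => forall_congr' fun M' => ?_
  refine forall_congr' fun hPM => forall_congr' fun _ => ?_
  exact ⟨fun h => by rw [h], fun h => hinj hPM hM' h⟩

theorem chsEdges_not_isDiag {m : ℕ} {k h : ℕ → ℤ} {e : Sym2 HexVertex}
    (he : e ∈ chsEdges m k h) : ¬ e.IsDiag := by
  obtain ⟨i, j, -, -, -, -, he⟩ := he
  simp only [HexVertex.hexEdges, Set.mem_insert_iff, Set.mem_singleton_iff] at he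
  rcases he with rfl | rfl | rfl | rfl | rfl | rfl <;>
    simp [HexVertex.edgeE, HexVertex.edgeL, HexVertex.edgeR]

theorem chs_adj_iff {m : ℕ} {k h : ℕ → ℤ} (x y : chsVerts m k h) :
    (chs m k h).Adj x y ↔ s(x.1, y.1) ∈ chsEdges m k h := by
  simp only [chs, SimpleGraph.comap_adj, Function.Embedding.subtype_apply,
    SimpleGraph.fromEdgeSet_adj, and_iff_left_iff_imp]
  intro he hxy
  exact chsEdges_not_isDiag he hxy

theorem image_edgeSet_perfectMatchings_chs (m : ℕ) (k h : ℕ → ℤ) :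
    Set.image (Sym2.map (Subtype.val : chsVerts m k h → HexVertex)) ''
      (SimpleGraph.Subgraph.edgeSet '' {M : (chs m k h).Subgraph | M.IsPerfectMatching}) =
    perfectMatchings (chsEdges m k h) := by
  have key : ∀ (M : (chs m k h).Subgraph) (x y : chsVerts m k h),
      s(x.1, y.1) ∈ Sym2.map Subtype.val '' M.edgeSet ↔ M.Adj x y := by
    intro M x y
    rw [← Sym2.map_mk, (Sym2.map.injective Subtype.val_injective).mem_set_image,
      SimpleGraph.Subgraph.mem_edgeSet]
  ext X
  constructor
  · rintro ⟨_, ⟨M, hM, rfl⟩, rfl⟩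
    rw [Set.mem_ofPred_eq, SimpleGraph.Subgraph.isPerfectMatching_iff] at hM
    refine ⟨?_, fun e he u hu => ?_⟩
    · rintro _ ⟨e, he, rfl⟩
      induction e using Sym2.ind with
      | _ x y => exact (chs_adj_iff x y).1 (M.adj_sub he)
    · obtain ⟨w, hw, huniq⟩ := hM ⟨u, e, he, hu⟩
      refine ⟨s(u, w.1), ⟨(key M ⟨u, e, he, hu⟩ w).2 hw, Sym2.mem_mk_left _ _⟩, ?_⟩
      rintro _ ⟨⟨e', he', rfl⟩, hue⟩
      induction e' using Sym2.ind with
      | _ x y =>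
        rw [SimpleGraph.Subgraph.mem_edgeSet] at he'
        rw [Sym2.map_mk, Sym2.mem_iff] at hue
        rcases hue with rfl | rfl
        · rw [← huniq y he', Sym2.map_mk]
        · rw [← huniq x he'.symm, Sym2.map_mk, Sym2.eq_swap]
  · rintro ⟨hXE, hX⟩
    let M : (chs m k h).Subgraph :=
      { verts := Set.univ
        Adj := fun x y => s(x.1, y.1) ∈ X
        adj_sub := fun {x y} hxy => (chs_adj_iff x y).2 (hXE hxy)
        edge_vert := fun _ => Set.mem_univ _
        symm := ⟨fun x y hxy => by rwa [Sym2.eq_swap]⟩ }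
    refine ⟨_, ⟨M, ?_, rfl⟩, ?_⟩
    · rw [Set.mem_ofPred_eq, SimpleGraph.Subgraph.isPerfectMatching_iff]
      rintro ⟨u, e, he, hu⟩
      obtain ⟨x, ⟨hxX, hux⟩, huniq⟩ := hX e he u hu
      obtain ⟨w, rfl⟩ := hux
      refine ⟨⟨w, _, hXE hxX, Sym2.mem_mk_right _ _⟩, hxX, ?_⟩
      rintro ⟨w', hw'⟩ hadj
      exact Subtype.ext (Sym2.congr_right.1 (huniq _ ⟨hadj, Sym2.mem_mk_left _ _⟩))
    · ext e
      induction e using Sym2.ind with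
      | _ a b =>
        constructor
        · rintro ⟨e', he', hee⟩
          induction e' using Sym2.ind with
          | _ x y =>
            rw [← hee]
            exact he'
        · intro hab
          exact (key M ⟨a, _, hXE hab, Sym2.mem_mk_left _ _⟩
            ⟨b, _, hXE hab, Sym2.mem_mk_right _ _⟩).2 hab

theorem chsForcingPoly_eq_family (m : ℕ) (k h : ℕ → ℤ) :
    chsForcingPoly m k h = familyForcingPoly (perfectMatchings (chsEdges m k h)) := by
  rw [chsForcingPoly, forcingPolynomial_eq_family, ← image_edgeSet_perfectMatchings_chs,
    familyForcingPoly_image (Sym2.map.injective Subtype.val_injective)]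

theorem perfectMatchings_antichain {V : Type*} {E : Set (Sym2 V)} {X Y : Set (Sym2 V)}
    (hX : X ∈ perfectMatchings E) (hY : Y ∈ perfectMatchings E) (h : X ⊆ Y) : Y = X := by
  refine Set.Subset.antisymm (fun e he => ?_) h
  induction e using Sym2.ind with
  | _ a b =>
    obtain ⟨x, hx, -⟩ := hX.2 _ (hY.1 he) a (Sym2.mem_mk_left _ _)
    have := (hY.2 _ (hY.1 he) a (Sym2.mem_mk_left _ _)).unique ⟨he, Sym2.mem_mk_left _ _⟩
      ⟨h hx.1, hx.2⟩
    rw [this]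
    exact hx.1

/-! ### Edges of the hexagonal lattice by type and position -/

/-- The edges of the hexagonal lattice: `vert i j`, `left i j` and `right i j` stand for
`e_{i,j}`, `l_{i,j}` and `r_{i,j}`. -/
inductive HexEdge : Type
  /-- the left vertical edge of `C i j` -/
  | vert (i j : ℤ) : HexEdge
  /-- the top left oblique edge of `C i j` -/
  | left (i j : ℤ) : HexEdge
  /-- the top right oblique edge of `C i j` -/
  | right (i j : ℤ) : HexEdge

namespace HexEdge

/-- The pair of end vertices of an edge. -/
def ends : HexEdge → Sym2 HexVertex
  | vert i j => HexVertex.edgeE i j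
  | left i j => HexVertex.edgeL i j
  | right i j => HexVertex.edgeR i j

theorem top_mem_ends {i j : ℤ} {a : HexEdge} :
    HexVertex.top i j ∈ a.ends ↔ a = vert (i - 1) j ∨ a = left i j ∨ a = right i j := by
  cases a <;> simp [ends, HexVertex.edgeE, HexVertex.edgeL, HexVertex.edgeR] <;> omega

theorem bot_mem_ends {i j : ℤ} {a : HexEdge} :
    HexVertex.bot (i - 1) (j + 1) ∈ a.ends ↔
      a = vert i j ∨ a = left i j ∨ a = right i (j + 1) := by
  cases a <;> simp [ends, HexVertex.edgeE, HexVertex.edgeL, HexVertex.edgeR] <;> omega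

theorem ends_injective : Function.Injective ends := by
  intro a b h
  cases a <;> cases b <;>
    simp_all [ends, HexVertex.edgeE, HexVertex.edgeL, HexVertex.edgeR] <;> omega

end HexEdge

/-- Exactly one of three propositions holds. -/
def ExactlyOne (p q r : Prop) : Prop :=
  (p ∧ ¬ q ∧ ¬ r) ∨ (¬ p ∧ q ∧ ¬ r) ∨ (¬ p ∧ ¬ q ∧ r)

theorem existsUnique_iff_exactlyOne {α : Type*} {Y : Set α} {a b c : α}
    (hab : a ≠ b) (hac : a ≠ c) (hbc : b ≠ c) :
    (∃! x, x ∈ Y ∧ (x = a ∨ x = b ∨ x = c)) ↔ ExactlyOne (a ∈ Y) (b ∈ Y) (c ∈ Y) := by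
  constructor
  · rintro ⟨x, ⟨hx, rfl | rfl | rfl⟩, hu⟩ <;> unfold ExactlyOne
    · exact Or.inl ⟨hx, fun h => hab.symm (hu _ ⟨h, by simp⟩),
        fun h => hac.symm (hu _ ⟨h, by simp⟩)⟩
    · exact Or.inr (Or.inl ⟨fun h => hab (hu _ ⟨h, by simp⟩), hx,
        fun h => hbc.symm (hu _ ⟨h, by simp⟩)⟩)
    · exact Or.inr (Or.inr ⟨fun h => hac (hu _ ⟨h, by simp⟩), fun h => hbc (hu _ ⟨h, by simp⟩), hx⟩)
  · rintro (⟨h1, h2, h3⟩ | ⟨h1, h2, h3⟩ | ⟨h1, h2, h3⟩)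
    · refine ⟨a, ⟨h1, by simp⟩, ?_⟩
      rintro y ⟨hy, rfl | rfl | rfl⟩ <;> first | rfl | contradiction
    · refine ⟨b, ⟨h2, by simp⟩, ?_⟩
      rintro y ⟨hy, rfl | rfl | rfl⟩ <;> first | rfl | contradiction
    · refine ⟨c, ⟨h3, by simp⟩, ?_⟩
      rintro y ⟨hy, rfl | rfl | rfl⟩ <;> first | rfl | contradiction

/-- The edges of the hexagons `C i j` with `H i ≤ j ≤ K i`, for all rows `i : ℤ`; each edge lies on
two hexagons of the tiling. -/
def systemEdges (K H : ℤ → ℤ) : Set HexEdge :=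
  {a | match a with
    | .vert i j => (H i ≤ j ∧ j ≤ K i) ∨ (H i ≤ j + 1 ∧ j + 1 ≤ K i)
    | .left i j => (H i ≤ j ∧ j ≤ K i) ∨ (H (i - 1) ≤ j + 1 ∧ j + 1 ≤ K (i - 1))
    | .right i j => (H i ≤ j ∧ j ≤ K i) ∨ (H (i - 1) ≤ j ∧ j ≤ K (i - 1))}

theorem vert_mem_systemEdges {K H : ℤ → ℤ} {i j : ℤ} : .vert i j ∈ systemEdges K H ↔
    (H i ≤ j ∧ j ≤ K i) ∨ (H i ≤ j + 1 ∧ j + 1 ≤ K i) := Iff.rfl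

theorem left_mem_systemEdges {K H : ℤ → ℤ} {i j : ℤ} : .left i j ∈ systemEdges K H ↔
    (H i ≤ j ∧ j ≤ K i) ∨ (H (i - 1) ≤ j + 1 ∧ j + 1 ≤ K (i - 1)) := Iff.rfl

theorem right_mem_systemEdges {K H : ℤ → ℤ} {i j : ℤ} : .right i j ∈ systemEdges K H ↔
    (H i ≤ j ∧ j ≤ K i) ∨ (H (i - 1) ≤ j ∧ j ≤ K (i - 1)) := Iff.rfl

/-- The rows of `CHS({k_s; h_s})` placed among the rows `i : ℤ`: `C i j` is a hexagon of the system
exactly if `H i ≤ j ≤ K i`. -/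
def IsRowExtension (m : ℕ) (k h : ℕ → ℤ) (K H : ℤ → ℤ) : Prop :=
  ∀ i j : ℤ, (H i ≤ j ∧ j ≤ K i) ↔ ∃ n : ℕ, i = n ∧ 1 ≤ n ∧ n ≤ m ∧ h n ≤ j ∧ j ≤ k n

theorem image_ends_systemEdges {m : ℕ} {k h : ℕ → ℤ} {K H : ℤ → ℤ}
    (hext : IsRowExtension m k h K H) :
    HexEdge.ends '' systemEdges K H = chsEdges m k h := by
  ext e
  constructor
  · rintro ⟨a, ha, rfl⟩
    have hin : ∀ i j : ℤ, H i ≤ j ∧ j ≤ K i → ∀ e ∈ HexVertex.hexEdges i j, e ∈ chsEdges m k h := by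
      intro i j hij e he
      obtain ⟨n, rfl, h1, h2, h3, h4⟩ := (hext i j).1 hij
      exact ⟨n, j, h1, h2, h3, h4, he⟩
    cases a with
    | vert i j =>
      rcases ha with ha | ha
      · exact hin _ _ ha _ (by simp [HexVertex.hexEdges, HexEdge.ends])
      · exact hin _ _ ha _ (by simp [HexVertex.hexEdges, HexEdge.ends])
    | left i j =>
      rcases ha with ha | ha
      · exact hin _ _ ha _ (by simp [HexVertex.hexEdges, HexEdge.ends])
      · exact hin _ _ ha _ (by simp [HexVertex.hexEdges, HexEdge.ends])
    | right i j =>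
      rcases ha with ha | ha
      · exact hin _ _ ha _ (by simp [HexVertex.hexEdges, HexEdge.ends])
      · exact hin _ _ ha _ (by simp [HexVertex.hexEdges, HexEdge.ends])
  · rintro ⟨n, j, h1, h2, h3, h4, he⟩
    have hij := (hext n j).2 ⟨n, rfl, h1, h2, h3, h4⟩
    simp only [HexVertex.hexEdges, Set.mem_insert_iff, Set.mem_singleton_iff] at he
    rcases he with rfl | rfl | rfl | rfl | rfl | rfl
    · exact ⟨.vert n j, Or.inl hij, rfl⟩
    · exact ⟨.left n j, Or.inl hij, rfl⟩
    · exact ⟨.right n j, Or.inl hij, rfl⟩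
    · exact ⟨.vert n (j - 1), Or.inr (by simpa using hij), rfl⟩
    · exact ⟨.left (n + 1) (j - 1), Or.inr (by simpa using hij), rfl⟩
    · exact ⟨.right (n + 1) j, Or.inr (by simpa using hij), rfl⟩

/-- The perfect matchings of the system with rows `H i ≤ j ≤ K i`: sets of edges covering exactly
once each topmost vertex of a hexagon `C i j`, and each bottommost vertex of a hexagon
`C (i-1) (j+1)`, that belongs to the system. -/
def systemMatchings (K H : ℤ → ℤ) : Set (Set HexEdge) :=
  {X | X ⊆ systemEdges K H ∧
    (∀ i j, (.vert (i - 1) j ∈ systemEdges K H ∨ .left i j ∈ systemEdges K H ∨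
        .right i j ∈ systemEdges K H) →
      ExactlyOne (.vert (i - 1) j ∈ X) (.left i j ∈ X) (.right i j ∈ X)) ∧
    ∀ i j, (.vert i j ∈ systemEdges K H ∨ .left i j ∈ systemEdges K H ∨
        .right i (j + 1) ∈ systemEdges K H) →
      ExactlyOne (.vert i j ∈ X) (.left i j ∈ X) (.right i (j + 1) ∈ X)}

theorem existsUnique_top_iff {Y : Set HexEdge} {i j : ℤ} :
    (∃! x, x ∈ HexEdge.ends '' Y ∧ HexVertex.top i j ∈ x) ↔
      ExactlyOne (.vert (i - 1) j ∈ Y) (.left i j ∈ Y) (.right i j ∈ Y) := by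
  rw [← existsUnique_iff_exactlyOne (by simp) (by simp) (by simp)]
  simp_rw [← HexEdge.top_mem_ends]
  constructor
  · rintro ⟨_, ⟨⟨a, ha, rfl⟩, hx⟩, hu⟩
    exact ⟨a, ⟨ha, hx⟩, fun b hb => HexEdge.ends_injective (hu _ ⟨⟨b, hb.1, rfl⟩, hb.2⟩)⟩
  · rintro ⟨a, ⟨ha, hx⟩, hu⟩
    refine ⟨a.ends, ⟨⟨a, ha, rfl⟩, hx⟩, ?_⟩
    rintro _ ⟨⟨b, hb, rfl⟩, hx'⟩
    rw [hu b ⟨hb, hx'⟩]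

theorem existsUnique_bot_iff {Y : Set HexEdge} {i j : ℤ} :
    (∃! x, x ∈ HexEdge.ends '' Y ∧ HexVertex.bot (i - 1) (j + 1) ∈ x) ↔
      ExactlyOne (.vert i j ∈ Y) (.left i j ∈ Y) (.right i (j + 1) ∈ Y) := by
  rw [← existsUnique_iff_exactlyOne (by simp) (by simp) (by simp)]
  simp_rw [← HexEdge.bot_mem_ends]
  constructor
  · rintro ⟨_, ⟨⟨a, ha, rfl⟩, hx⟩, hu⟩
    exact ⟨a, ⟨ha, hx⟩, fun b hb => HexEdge.ends_injective (hu _ ⟨⟨b, hb.1, rfl⟩, hb.2⟩)⟩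
  · rintro ⟨a, ⟨ha, hx⟩, hu⟩
    refine ⟨a.ends, ⟨⟨a, ha, rfl⟩, hx⟩, ?_⟩
    rintro _ ⟨⟨b, hb, rfl⟩, hx'⟩
    rw [hu b ⟨hb, hx'⟩]

theorem image_systemMatchings (K H : ℤ → ℤ) :
    Set.image HexEdge.ends '' systemMatchings K H =
      perfectMatchings (HexEdge.ends '' systemEdges K H) := by
  ext X
  constructor
  · rintro ⟨Y, ⟨hYE, ht, hb⟩, rfl⟩
    refine ⟨Set.image_mono hYE, ?_⟩
    rintro _ ⟨a, ha, rfl⟩ u hu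
    cases u with
    | top i j =>
      rw [existsUnique_top_iff]
      refine ht i j ?_
      rcases HexEdge.top_mem_ends.1 hu with rfl | rfl | rfl <;> simp [ha]
    | bot i j =>
      obtain ⟨i, rfl⟩ : ∃ i', i = i' - 1 := ⟨i + 1, by ring⟩
      obtain ⟨j, rfl⟩ : ∃ j', j = j' + 1 := ⟨j - 1, by ring⟩
      rw [existsUnique_bot_iff]
      refine hb i j ?_
      rcases HexEdge.bot_mem_ends.1 hu with rfl | rfl | rfl <;> simp [ha]
  · rintro ⟨hXE, hX⟩
    obtain ⟨Y, hYE, rfl⟩ := Set.subset_image_iff.1 hXE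
    refine ⟨Y, ⟨hYE, fun i j hij => ?_, fun i j hij => ?_⟩, rfl⟩
    · rw [← existsUnique_top_iff]
      rcases hij with h | h | h
      all_goals exact hX _ ⟨_, h, rfl⟩ _ (HexEdge.top_mem_ends.2 (by simp))
    · rw [← existsUnique_bot_iff]
      rcases hij with h | h | h
      all_goals exact hX _ ⟨_, h, rfl⟩ _ (HexEdge.bot_mem_ends.2 (by simp))

theorem chsForcingPoly_eq_system {m : ℕ} {k h : ℕ → ℤ} {K H : ℤ → ℤ}
    (hext : IsRowExtension m k h K H) :
    chsForcingPoly m k h = familyForcingPoly (systemMatchings K H) := by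
  rw [chsForcingPoly_eq_family, ← image_ends_systemEdges hext, ← image_systemMatchings,
    familyForcingPoly_image HexEdge.ends_injective]

theorem finite_systemEdges {m : ℕ} {k h : ℕ → ℤ} {K H : ℤ → ℤ}
    (hext : IsRowExtension m k h K H) : (systemEdges K H).Finite := by
  have := chsEdges_finite m k h
  rw [← image_ends_systemEdges hext] at this
  exact this.of_finite_image HexEdge.ends_injective.injOn

theorem finite_systemMatchings {K H : ℤ → ℤ} (hfin : (systemEdges K H).Finite) :
    (systemMatchings K H).Finite :=
  hfin.finite_subsets.subset fun _ hX => hX.1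

theorem systemMatchings_antichain {K H : ℤ → ℤ} {X Y : Set HexEdge}
    (hX : X ∈ systemMatchings K H) (hY : Y ∈ systemMatchings K H) (h : X ⊆ Y) : Y = X := by
  refine HexEdge.ends_injective.image_injective
    (perfectMatchings_antichain (E := HexEdge.ends '' systemEdges K H) ?_ ?_ (Set.image_mono h))
  · rw [← image_systemMatchings]
    exact ⟨X, hX, rfl⟩
  · rw [← image_systemMatchings]
    exact ⟨Y, hY, rfl⟩

/-! ### Perfect matchings as monotone paths -/

/-- Rows `H i ≤ j ≤ K i` whose left and right ends move weakly to the left going down. A row may be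
empty only in the form `K i = H i - 1`, and the rows `i ≤ 0` are empty. -/
structure IsRowSystem (K H : ℤ → ℤ) : Prop where
  monotone_left : Monotone K
  monotone_right : Monotone H
  right_le : ∀ i, H i ≤ K i + 1
  empty : ∀ i ≤ 0, H i = K i + 1

/-- A path through a row system: it crosses row `i` at the vertical edge `e_{i, v i}`, one of the
vertical edges of the row, and moves weakly to the left going down. In an empty row the only
admissible value is `K i = H i - 1`, although there is no edge. -/
structure IsPath (K H v : ℤ → ℤ) : Prop where
  monotone : Monotone v
  right_le : ∀ i, H i ≤ v i + 1
  le_left : ∀ i, v i ≤ K i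

/-- The set of edges of the row system matched according to the path `v`. -/
def pathMatching (K H v : ℤ → ℤ) : Set HexEdge :=
  {a | a ∈ systemEdges K H ∧ match a with
    | .vert i j => v i = j
    | .left i j => j < v (i - 1) ∨ v i < j
    | .right i j => v (i - 1) < j ∧ j ≤ v i}

theorem vert_mem_pathMatching {K H v : ℤ → ℤ} {i j : ℤ} : .vert i j ∈ pathMatching K H v ↔
    .vert i j ∈ systemEdges K H ∧ v i = j := Iff.rfl

theorem left_mem_pathMatching {K H v : ℤ → ℤ} {i j : ℤ} : .left i j ∈ pathMatching K H v ↔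
    .left i j ∈ systemEdges K H ∧ (j < v (i - 1) ∨ v i < j) := Iff.rfl

theorem right_mem_pathMatching {K H v : ℤ → ℤ} {i j : ℤ} : .right i j ∈ pathMatching K H v ↔
    .right i j ∈ systemEdges K H ∧ v (i - 1) < j ∧ j ≤ v i := Iff.rfl

theorem pathMatching_mem {K H v : ℤ → ℤ} (hs : IsRowSystem K H) (hv : IsPath K H v) :
    pathMatching K H v ∈ systemMatchings K H := by
  refine ⟨fun a ha => ha.1, fun i j hij => ?_, fun i j hij => ?_⟩ <;>
  · have h1 := hs.monotone_left (show i - 1 ≤ i by omega)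
    have h2 := hs.monotone_right (show i - 1 ≤ i by omega)
    have h3 := hv.monotone (show i - 1 ≤ i by omega)
    have h4 := hv.right_le i
    have h5 := hv.right_le (i - 1)
    have h6 := hv.le_left i
    have h7 := hv.le_left (i - 1)
    simp only [ExactlyOne, vert_mem_pathMatching, left_mem_pathMatching, right_mem_pathMatching,
      vert_mem_systemEdges, left_mem_systemEdges, right_mem_systemEdges] at hij ⊢
    omega

/-- Between two consecutive rows, let `r j` say that the edge `r_{i,j}` is matched and `y j` that
the vertical edge `e_{i,j}` is. Read as numbers, the covering conditions give
`r (j+1) - r j = [j = v] - y j`, where `v` is the vertical edge matched in the row above. Since `r`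
has bounded support, exactly one vertical edge is matched below, at some `w ≥ v`. -/
theorem exists_next_crossing {r y : ℤ → Prop} {v a b : ℤ}
    (hne : ∀ j, j ≠ v → (¬ y j ∧ (r (j + 1) ↔ r j)) ∨ (y j ∧ r j ∧ ¬ r (j + 1)))
    (heq : (y v ∧ (r (v + 1) ↔ r v)) ∨ (¬ y v ∧ ¬ r v ∧ r (v + 1)))
    (ha : ∀ j ≤ a, ¬ r j) (hb : ∀ j, b ≤ j → ¬ r j) :
    ∃ w, v ≤ w ∧ (∀ j, y j ↔ j = w) ∧ ∀ j, r j ↔ v < j ∧ j ≤ w := by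
  have hlow : ∀ j ≤ v, ¬ r j := by
    have h : ∀ j, min a v ≤ j → j ≤ v → ¬ r j := by
      intro j hj
      induction j, hj using Int.leInduction with
      | base => exact fun _ => ha _ (min_le_left _ _)
      | succ j hj ih =>
        intro hjv
        have := hne j (by omega)
        have := ih (by omega)
        tauto
    intro j hj
    by_cases hja : j ≤ a
    · exact ha j hja
    · exact h j (by omega) hj
  obtain ⟨w, ⟨hvw, hyw⟩, hmin⟩ : ∃ w, (v ≤ w ∧ y w) ∧ ∀ z, v ≤ z ∧ y z → w ≤ z := by
    refine Int.exists_least_of_bdd (P := fun z => v ≤ z ∧ y z) ⟨v, fun z hz => hz.1⟩ ?_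
    by_contra hno
    have hno' : ∀ z, v ≤ z → ¬ y z := fun z hz hy => hno ⟨z, hz, hy⟩
    have h : ∀ j, v + 1 ≤ j → r j := by
      intro j hj
      induction j, hj using Int.leInduction with
      | base =>
        have := hno' v le_rfl
        tauto
      | succ j hj ih =>
        have := hne j (by omega)
        have := hno' j (by omega)
        tauto
    exact hb (max b (v + 1)) (le_max_left _ _) (h _ (le_max_right _ _))
  have hmid : ∀ j, v + 1 ≤ j → j ≤ w → r j := by
    intro j hj
    induction j, hj using Int.leInduction with
    | base =>
      intro hw
      have hyv : ¬ y v := fun hy => absurd (hmin v ⟨le_rfl, hy⟩) (by omega)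
      tauto
    | succ j hj ih =>
      intro hw
      have hyj : ¬ y j := fun hy => absurd (hmin j ⟨by omega, hy⟩) (by omega)
      have := hne j (by omega)
      have := ih (by omega)
      tauto
  have hhigh : ∀ j, w + 1 ≤ j → ¬ r j := by
    intro j hj
    induction j, hj using Int.leInduction with
    | base =>
      rcases eq_or_lt_of_le hvw with rfl | hlt
      · have := hlow v le_rfl
        tauto
      · have := hne w (by omega)
        tauto
    | succ j hj ih =>
      have := hne j (by omega)
      tauto
  refine ⟨w, hvw, fun j => ⟨fun hy => ?_, fun h => h ▸ hyw⟩, fun j => ⟨fun hr => ?_, fun h => ?_⟩⟩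
  · by_contra hjw
    rcases lt_trichotomy j v with hlt | rfl | hgt
    · have := hne j (by omega)
      have := hlow j (by omega)
      tauto
    · have := hmin j ⟨le_rfl, hy⟩
      omega
    · have h1 := hmin j ⟨hgt.le, hy⟩
      have := hne j (by omega)
      have := hhigh j (by omega)
      tauto
  · constructor
    · by_contra hj
      exact hlow j (by omega) hr
    · by_contra hj
      exact hhigh j (by omega) hr
  · exact hmid j (by omega) h.2

/-- The matched vertical edge of row `i`, where an empty row is given the crossing point `K i`. -/
def IsCrossing (K H : ℤ → ℤ) (X : Set HexEdge) (i j : ℤ) : Prop :=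
  .vert i j ∈ X ∨ (H i = K i + 1 ∧ j = K i)

set_option linter.unusedSimpArgs false in
/-- The relation required by `exists_next_crossing` at position `j` between two consecutive rows
`h ≤ j ≤ k` and `h' ≤ j ≤ k'`. Here `p1`, …, `p5` say that `e_{i-1,j}`, `l_{i,j}`, `r_{i,j}`,
`e_{i,j}` and `r_{i,j+1}` are matched; `e1`, …, `e5` that only edges of the system are matched; and
`t`, `b` that the vertices `top i j` and `bot (i-1) (j+1)` are covered exactly once if they belong
to the system. An empty row counts as crossed at its only admissible value, and the gap `k < j < h'`
between rows that do not touch counts as matched by right edges. -/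
theorem crossing_step {k h k' h' j : ℤ} (h1 : k ≤ k') (h2 : h ≤ h') (h3 : h' ≤ k' + 1)
    (h4 : h ≤ k + 1) {p1 p2 p3 p4 p5 : Prop}
    (e1 : p1 → h ≤ j ∧ j ≤ k ∨ h ≤ j + 1 ∧ j + 1 ≤ k)
    (e2 : p2 → h' ≤ j ∧ j ≤ k' ∨ h ≤ j + 1 ∧ j + 1 ≤ k)
    (e3 : p3 → h' ≤ j ∧ j ≤ k' ∨ h ≤ j ∧ j ≤ k)
    (e4 : p4 → h' ≤ j ∧ j ≤ k' ∨ h' ≤ j + 1 ∧ j + 1 ≤ k')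
    (e5 : p5 → h' ≤ j + 1 ∧ j + 1 ≤ k' ∨ h ≤ j + 1 ∧ j + 1 ≤ k)
    (t : (h ≤ j ∧ j ≤ k ∨ h ≤ j + 1 ∧ j + 1 ≤ k) ∨ (h' ≤ j ∧ j ≤ k' ∨ h ≤ j + 1 ∧ j + 1 ≤ k) ∨
      (h' ≤ j ∧ j ≤ k' ∨ h ≤ j ∧ j ≤ k) → ExactlyOne p1 p2 p3)
    (b : (h' ≤ j ∧ j ≤ k' ∨ h' ≤ j + 1 ∧ j + 1 ≤ k') ∨
      (h' ≤ j ∧ j ≤ k' ∨ h ≤ j + 1 ∧ j + 1 ≤ k) ∨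
      (h' ≤ j + 1 ∧ j + 1 ≤ k' ∨ h ≤ j + 1 ∧ j + 1 ≤ k) → ExactlyOne p4 p2 p5) :
    ((p1 ∨ (h = k + 1 ∧ j = k)) ∧
      (((p4 ∨ (h' = k' + 1 ∧ j = k')) ∧
        ((p5 ∨ (k < j + 1 ∧ j + 1 < h')) ↔ (p3 ∨ (k < j ∧ j < h')))) ∨
      (¬ (p4 ∨ (h' = k' + 1 ∧ j = k')) ∧ ¬ (p3 ∨ (k < j ∧ j < h')) ∧
        (p5 ∨ (k < j + 1 ∧ j + 1 < h'))))) ∨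
    (¬ (p1 ∨ (h = k + 1 ∧ j = k)) ∧
      ((¬ (p4 ∨ (h' = k' + 1 ∧ j = k')) ∧
        ((p5 ∨ (k < j + 1 ∧ j + 1 < h')) ↔ (p3 ∨ (k < j ∧ j < h')))) ∨
      ((p4 ∨ (h' = k' + 1 ∧ j = k')) ∧ (p3 ∨ (k < j ∧ j < h')) ∧
        ¬ (p5 ∨ (k < j + 1 ∧ j + 1 < h'))))) := by
  unfold ExactlyOne at t b
  by_cases hT : h ≤ j + 1 ∧ j ≤ k ∧ h ≤ k ∨ h' ≤ j ∧ j ≤ k' <;>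
  by_cases hB : h ≤ j + 1 ∧ j + 1 ≤ k ∨ h' ≤ j + 1 ∧ j ≤ k' ∧ h' ≤ k'
  · rcases t (by omega) with ⟨q1, q2, q3⟩ | ⟨q1, q2, q3⟩ | ⟨q1, q2, q3⟩ <;>
    rcases b (by omega) with ⟨q4, q2', q5⟩ | ⟨q4, q2', q5⟩ | ⟨q4, q2', q5⟩ <;>
    first
    | contradiction
    | (simp only [q1, q2, q3, q4, q5, true_or, false_or, true_and, false_and,
        and_true, and_false, not_true_eq_false, not_false_eq_true, true_iff, iff_true, false_iff,
        iff_false,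
        true_implies, false_implies] at e1 e2 e3 e4 e5 ⊢
       omega)
  · have q2 : ¬ p2 := fun h => by have := e2 h; omega
    have q4 : ¬ p4 := fun h => by have := e4 h; omega
    have q5 : ¬ p5 := fun h => by have := e5 h; omega
    rcases t (by omega) with ⟨q1, -, q3⟩ | ⟨-, h, -⟩ | ⟨q1, -, q3⟩
    · have := e1 q1
      simp only [q1, q3, q4, q5, true_or, false_or, true_and, false_and,
        and_true, and_false, not_true_eq_false, not_false_eq_true, true_iff, iff_true, false_iff,
        iff_false]
      omega
    · contradiction
    · have := e3 q3
      simp only [q1, q3, q4, q5, true_or, false_or, true_and, false_and,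
        and_true, and_false, not_true_eq_false, not_false_eq_true, true_iff, iff_true, false_iff,
        iff_false]
      omega
  · have q2 : ¬ p2 := fun h => by have := e2 h; omega
    have q1 : ¬ p1 := fun h => by have := e1 h; omega
    have q3 : ¬ p3 := fun h => by have := e3 h; omega
    rcases b (by omega) with ⟨q4, -, q5⟩ | ⟨-, h, -⟩ | ⟨q4, -, q5⟩
    · have := e4 q4
      simp only [q1, q3, q4, q5, true_or, false_or, true_and, false_and,
        and_true, and_false, not_true_eq_false, not_false_eq_true, true_iff, iff_true, false_iff,
        iff_false]
      omega
    · contradiction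
    · have := e5 q5
      simp only [q1, q3, q4, q5, true_or, false_or, true_and, false_and,
        and_true, and_false, not_true_eq_false, not_false_eq_true, true_iff, iff_true, false_iff,
        iff_false]
      omega
  · have q1 : ¬ p1 := fun h => by have := e1 h; omega
    have q3 : ¬ p3 := fun h => by have := e3 h; omega
    have q4 : ¬ p4 := fun h => by have := e4 h; omega
    have q5 : ¬ p5 := fun h => by have := e5 h; omega
    simp only [q1, q3, q4, q5, false_or]
    omega

/-- If exactly one vertical edge is matched in row `i - 1`, the same holds in row `i`, weakly
further to the left, and the right edges matched in between are those strictly after the upper crossing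
and up to the lower one. -/
theorem exists_crossing_succ {K H : ℤ → ℤ} (hs : IsRowSystem K H) {X : Set HexEdge}
    (hX : X ∈ systemMatchings K H) {i v : ℤ}
    (hv : ∀ j, IsCrossing K H X (i - 1) j ↔ j = v) :
    ∃ w, v ≤ w ∧ (∀ j, IsCrossing K H X i j ↔ j = w) ∧
      ∀ j, (.right i j ∈ X ∨ (K (i - 1) < j ∧ j < H i)) ↔ v < j ∧ j ≤ w := by
  obtain ⟨hXE, ht, hb⟩ := hX
  have h1 := hs.monotone_left (show i - 1 ≤ i by omega)
  have h2 := hs.monotone_right (show i - 1 ≤ i by omega)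
  have h3 := hs.right_le i
  have h4 := hs.right_le (i - 1)
  -- The gap `K (i - 1) < j < H i` between the two rows counts as matched by `r_{i,j}`.
  have step : ∀ j, (IsCrossing K H X (i - 1) j ∧ ((IsCrossing K H X i j ∧
        ((.right i (j + 1) ∈ X ∨ (K (i - 1) < j + 1 ∧ j + 1 < H i)) ↔
          (.right i j ∈ X ∨ (K (i - 1) < j ∧ j < H i)))) ∨
        (¬ IsCrossing K H X i j ∧ ¬ (.right i j ∈ X ∨ (K (i - 1) < j ∧ j < H i)) ∧
          (.right i (j + 1) ∈ X ∨ (K (i - 1) < j + 1 ∧ j + 1 < H i))))) ∨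
      (¬ IsCrossing K H X (i - 1) j ∧ ((¬ IsCrossing K H X i j ∧
        ((.right i (j + 1) ∈ X ∨ (K (i - 1) < j + 1 ∧ j + 1 < H i)) ↔
          (.right i j ∈ X ∨ (K (i - 1) < j ∧ j < H i)))) ∨
        (IsCrossing K H X i j ∧ (.right i j ∈ X ∨ (K (i - 1) < j ∧ j < H i)) ∧
          ¬ (.right i (j + 1) ∈ X ∨ (K (i - 1) < j + 1 ∧ j + 1 < H i))))) := by
    intro j
    exact crossing_step h1 h2 h3 h4 (@hXE _) (@hXE _) (@hXE _) (@hXE _) (@hXE _) (ht i j) (hb i j)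
  refine exists_next_crossing (a := H (i - 1) - 1) (b := K i + 1) ?_ ?_ ?_ ?_
  · intro j hj
    exact ((step j).resolve_left fun h => hj ((hv j).1 h.1)).2
  · exact ((step v).resolve_right fun h => h.1 ((hv v).2 rfl)).2
  · rintro j hj (h | h)
    · have := right_mem_systemEdges.1 (hXE h)
      omega
    · omega
  · rintro j hj (h | h)
    · have := right_mem_systemEdges.1 (hXE h)
      omega
    · omega

theorem exists_crossing {K H : ℤ → ℤ} (hs : IsRowSystem K H) {X : Set HexEdge}
    (hX : X ∈ systemMatchings K H) (i : ℤ) : ∃ v, ∀ j, IsCrossing K H X i j ↔ j = v := by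
  have hempty : ∀ i ≤ 0, ∃ v, ∀ j, IsCrossing K H X i j ↔ j = v := by
    intro i hi
    refine ⟨K i, fun j => ⟨?_, fun h => Or.inr ⟨hs.empty i hi, h⟩⟩⟩
    rintro (h | h)
    · have := vert_mem_systemEdges.1 (hX.1 h)
      have := hs.empty i hi
      omega
    · exact h.2
  rcases le_total i 0 with hi | hi
  · exact hempty i hi
  · induction i, hi using Int.leInduction with
    | base => exact hempty 0 le_rfl
    | succ i hi ih =>
      obtain ⟨v, hv⟩ := ih
      obtain ⟨w, -, hw, -⟩ := exists_crossing_succ (i := i + 1) hs hX (by simpa using hv)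
      exact ⟨w, hw⟩

theorem exists_path {K H : ℤ → ℤ} (hs : IsRowSystem K H) {X : Set HexEdge}
    (hX : X ∈ systemMatchings K H) : ∃ v, IsPath K H v ∧ X = pathMatching K H v := by
  choose v hv using exists_crossing hs hX
  have hnext : ∀ i, v (i - 1) ≤ v i ∧
      ∀ j, (.right i j ∈ X ∨ (K (i - 1) < j ∧ j < H i)) ↔ v (i - 1) < j ∧ j ≤ v i := by
    intro i
    obtain ⟨w, h1, h2, h3⟩ := exists_crossing_succ hs hX (hv (i - 1))
    obtain rfl : v i = w := (h2 _).1 ((hv i _).2 rfl)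
    exact ⟨h1, h3⟩
  have hpath : IsPath K H v := by
    have hrow : ∀ i, H i ≤ v i + 1 ∧ v i ≤ K i := by
      intro i
      rcases (hv i _).2 rfl with h | h
      · have := vert_mem_systemEdges.1 (hX.1 h)
        omega
      · omega
    refine ⟨monotone_int_of_le_succ fun i => ?_, fun i => (hrow i).1, fun i => (hrow i).2⟩
    simpa using (hnext (i + 1)).1
  refine ⟨v, hpath, ?_⟩
  have hvert : ∀ i j, .vert i j ∈ X ↔ .vert i j ∈ pathMatching K H v := by
    intro i j
    rw [vert_mem_pathMatching, eq_comm, ← hv i j, IsCrossing]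
    refine ⟨fun h => ⟨hX.1 h, Or.inl h⟩, ?_⟩
    rintro ⟨h1, h2 | h2⟩
    · exact h2
    · have := vert_mem_systemEdges.1 h1
      omega
  have hright : ∀ i j, .right i j ∈ X ↔ .right i j ∈ pathMatching K H v := by
    intro i j
    rw [right_mem_pathMatching, ← (hnext i).2 j]
    refine ⟨fun h => ⟨hX.1 h, Or.inl h⟩, ?_⟩
    rintro ⟨h1, h2 | h2⟩
    · exact h2
    · have := right_mem_systemEdges.1 h1
      omega
  have hleft : ∀ i j, .left i j ∈ X ↔ .left i j ∈ pathMatching K H v := by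
    intro i j
    have hP := pathMatching_mem hs hpath
    by_cases he : .left i j ∈ systemEdges K H
    · have h1 := hX.2.1 i j (Or.inr (Or.inl he))
      have h2 := hP.2.1 i j (Or.inr (Or.inl he))
      rw [← hvert, ← hright] at h2
      unfold ExactlyOne at h1 h2
      tauto
    · exact ⟨fun h => absurd (hX.1 h) he, fun h => absurd h.1 he⟩
  ext a
  cases a with
  | vert i j => exact hvert i j
  | left i j => exact hleft i j
  | right i j => exact hright i j

/-! ### Fixing the lower part of a path -/

/-- The function that agrees with `f` above row `n` and with `g` from row `n` on. -/
def splice (n : ℤ) (f g : ℤ → ℤ) (i : ℤ) : ℤ := if i < n then f i else g i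

theorem splice_of_lt {n i : ℤ} (f g : ℤ → ℤ) (h : i < n) : splice n f g i = f i := if_pos h

theorem splice_of_le {n i : ℤ} (f g : ℤ → ℤ) (h : n ≤ i) : splice n f g i = g i :=
  if_neg (not_lt.2 h)

/-- The left ends of the rows after cutting off all hexagons in the rows `i ≥ n` and all hexagons
`C i j` with `j > c`. -/
def cutLeft (K : ℤ → ℤ) (n c : ℤ) : ℤ → ℤ := splice n (fun i => min (K i) c) fun _ => c

/-- The right ends of the rows after cutting off all hexagons in the rows `i ≥ n` and all hexagons
`C i j` with `j > c`; the rows `i ≥ n` become empty. -/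
def cutRight (H : ℤ → ℤ) (n c : ℤ) : ℤ → ℤ := splice n H fun _ => c + 1

theorem IsRowSystem.cut {K H : ℤ → ℤ} (hs : IsRowSystem K H) {n c : ℤ} (hn : 1 ≤ n)
    (hc : ∀ i < n, H i ≤ c + 1) : IsRowSystem (cutLeft K n c) (cutRight H n c) := by
  constructor
  · refine monotone_int_of_le_succ fun i => ?_
    have := hs.monotone_left (show i ≤ i + 1 by omega)
    simp only [cutLeft, splice]
    split_ifs <;> omega
  · refine monotone_int_of_le_succ fun i => ?_
    have := hs.monotone_right (show i ≤ i + 1 by omega)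
    have := hc i
    simp only [cutRight, splice]
    split_ifs <;> omega
  · intro i
    have := hs.right_le i
    have := hc i
    simp only [cutLeft, cutRight, splice]
    split_ifs <;> omega
  · intro i hi
    have := hs.empty i hi
    have := hc i
    simp only [cutLeft, cutRight, splice]
    split_ifs <;> omega

/-- `d` is a possible lower part, from row `n` on, of paths that reach at most `c` above row `n`. -/
structure IsTail (K H : ℤ → ℤ) (n c : ℤ) (d : ℤ → ℤ) : Prop where
  le_succ : ∀ i, n ≤ i → d i ≤ d (i + 1)
  le : ∀ i, n ≤ i → c ≤ d i
  right_le : ∀ i, n ≤ i → H i ≤ d i + 1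
  le_left : ∀ i, n ≤ i → d i ≤ K i

theorem IsPath.splice {K H : ℤ → ℤ} {n c : ℤ} {d w : ℤ → ℤ} (hd : IsTail K H n c d)
    (hw : IsPath (cutLeft K n c) (cutRight H n c) w) : IsPath K H (splice n w d) := by
  have hw1 := hw.right_le
  have hw2 := hw.le_left
  simp only [cutLeft, cutRight, _root_.splice] at hw1 hw2
  constructor
  · refine monotone_int_of_le_succ fun i => ?_
    have := hw.monotone (show i ≤ i + 1 by omega)
    have := hd.le_succ i
    have := hd.le (i + 1)
    have := hw2 i
    simp only [_root_.splice]
    split_ifs at * <;> omega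
  · intro i
    have := hw1 i
    have := hd.right_le i
    simp only [_root_.splice]
    split_ifs at * <;> omega
  · intro i
    have := hw2 i
    have := hd.le_left i
    simp only [_root_.splice]
    split_ifs at * <;> omega

theorem isPath_cutLeft {K H : ℤ → ℤ} (hs : IsRowSystem K H) {n c : ℤ} (hn : 1 ≤ n)
    (hc : ∀ i < n, H i ≤ c + 1) : IsPath (cutLeft K n c) (cutRight H n c) (cutLeft K n c) :=
  ⟨(hs.cut hn hc).monotone_left, (hs.cut hn hc).right_le, fun _ => le_rfl⟩

theorem systemEdges_cut_subset (K H : ℤ → ℤ) (n c : ℤ) :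
    systemEdges (cutLeft K n c) (cutRight H n c) ⊆ systemEdges K H := by
  have h : ∀ i j, cutRight H n c i ≤ j ∧ j ≤ cutLeft K n c i → H i ≤ j ∧ j ≤ K i := by
    intro i j
    simp only [cutLeft, cutRight, splice]
    split_ifs <;> omega
  intro a ha
  cases a with
  | vert i j => exact Or.imp (h _ _) (h _ _) ha
  | left i j => exact Or.imp (h _ _) (h _ _) ha
  | right i j => exact Or.imp (h _ _) (h _ _) ha

/-- An edge of the cut system is matched by a path exactly if it is matched by its upper part. -/
theorem mem_pathMatching_splice {K H : ℤ → ℤ} {n c : ℤ} {d w : ℤ → ℤ} (hd : IsTail K H n c d)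
    (hw : IsPath (cutLeft K n c) (cutRight H n c) w) {a : HexEdge}
    (ha : a ∈ systemEdges (cutLeft K n c) (cutRight H n c)) :
    a ∈ pathMatching K H (splice n w d) ↔
      a ∈ pathMatching (cutLeft K n c) (cutRight H n c) w := by
  have haE := systemEdges_cut_subset K H n c ha
  cases a with
  | vert i j =>
    rw [vert_mem_pathMatching, vert_mem_pathMatching, and_iff_right haE, and_iff_right ha]
    rw [vert_mem_systemEdges] at ha
    simp only [cutLeft, cutRight, splice] at ha ⊢
    split_ifs at * <;> omega
  | left i j =>
    rw [left_mem_pathMatching, left_mem_pathMatching, and_iff_right haE, and_iff_right ha]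
    rw [left_mem_systemEdges] at ha
    have := hd.le i
    have h1 := hw.right_le i
    have h2 := hw.le_left i
    simp only [cutLeft, cutRight, splice] at ha h1 h2 ⊢
    split_ifs at * <;> omega
  | right i j =>
    rw [right_mem_pathMatching, right_mem_pathMatching, and_iff_right haE, and_iff_right ha]
    rw [right_mem_systemEdges] at ha
    have := hd.le i
    have h1 := hw.right_le i
    have h2 := hw.le_left i
    simp only [cutLeft, cutRight, splice] at ha h1 h2 ⊢
    split_ifs at * <;> omega

/-- Outside the cut system the matched edges depend on the lower part of the path only. -/
theorem mem_pathMatching_splice_congr {K H : ℤ → ℤ} (hs : IsRowSystem K H) {n c : ℤ}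
    {d w w' : ℤ → ℤ}
    (hw : IsPath (cutLeft K n c) (cutRight H n c) w)
    (hw' : IsPath (cutLeft K n c) (cutRight H n c) w')
    {a : HexEdge} (ha : a ∉ systemEdges (cutLeft K n c) (cutRight H n c)) :
    a ∈ pathMatching K H (splice n w d) ↔ a ∈ pathMatching K H (splice n w' d) := by
  have hw1 := hw.right_le
  have hw2 := hw.le_left
  have hw1' := hw'.right_le
  have hw2' := hw'.le_left
  cases a with
  | vert i j =>
    rw [vert_mem_pathMatching, vert_mem_pathMatching]
    refine and_congr_right fun he => ?_
    rw [vert_mem_systemEdges] at ha he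
    have h1 := hw1 i
    have h2 := hw2 i
    have h3 := hw1' i
    have h4 := hw2' i
    clear hw1 hw2 hw1' hw2'
    simp only [cutLeft, cutRight, splice] at ha h1 h2 h3 h4 ⊢
    split_ifs at * <;> omega
  | left i j =>
    rw [left_mem_pathMatching, left_mem_pathMatching]
    refine and_congr_right fun he => ?_
    rw [left_mem_systemEdges] at ha he
    have h0 := hs.monotone_right (show i - 1 ≤ i by omega)
    have h1 := hw1 i
    have h2 := hw2 i
    have h3 := hw1' i
    have h4 := hw2' i
    have h5 := hw1 (i - 1)
    have h6 := hw2 (i - 1)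
    have h7 := hw1' (i - 1)
    have h8 := hw2' (i - 1)
    clear hw1 hw2 hw1' hw2'
    simp only [cutLeft, cutRight, splice] at ha h1 h2 h3 h4 h5 h6 h7 h8 ⊢
    split_ifs at * <;> omega
  | right i j =>
    rw [right_mem_pathMatching, right_mem_pathMatching]
    refine and_congr_right fun he => ?_
    rw [right_mem_systemEdges] at ha he
    have h0 := hs.monotone_right (show i - 1 ≤ i by omega)
    have h1 := hw1 i
    have h2 := hw2 i
    have h3 := hw1' i
    have h4 := hw2' i
    have h5 := hw1 (i - 1)
    have h6 := hw2 (i - 1)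
    have h7 := hw1' (i - 1)
    have h8 := hw2' (i - 1)
    clear hw1 hw2 hw1' hw2'
    simp only [cutLeft, cutRight, splice] at ha h1 h2 h3 h4 h5 h6 h7 h8 ⊢
    split_ifs at * <;> omega

/-- If the matchings containing the edge `e` are those of the paths with lower part `d` that reach
at most `c` above row `n`, they contribute `x` times the forcing polynomial of the cut system. The
second possible lower part `d'` supplies, for each such matching, one that agrees with it on the cut
system; when `d'` differs from `d` at row `n` only, the two differ by one alternating hexagon. -/
theorem finsum_forcing_cut {K H : ℤ → ℤ} (hs : IsRowSystem K H) (hfin : (systemEdges K H).Finite)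
    {n c : ℤ} (hn : 1 ≤ n) (hc : ∀ i < n, H i ≤ c + 1) {d d' : ℤ → ℤ} (hd : IsTail K H n c d)
    (hd' : IsTail K H n c d') (hne : ∃ i, n ≤ i ∧ d' i ≠ d i) {e : HexEdge}
    (heE : e ∉ systemEdges (cutLeft K n c) (cutRight H n c))
    (he : ∀ v, IsPath K H v → (e ∈ pathMatching K H v ↔ v (n - 1) ≤ c ∧ ∀ i, n ≤ i → v i = d i)) :
    ∑ᶠ M ∈ {M ∈ systemMatchings K H | e ∈ M},
        (X : ℤ[X]) ^ familyForcingNumber (systemMatchings K H) M =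
      familyForcingPoly (systemMatchings (cutLeft K n c) (cutRight H n c)) * X := by
  have hs' := hs.cut hn hc
  have hK := isPath_cutLeft hs hn hc
  set E' := systemEdges (cutLeft K n c) (cutRight H n c) with hE'
  have hfin' : E'.Finite := hfin.subset (systemEdges_cut_subset K H n c)
  -- The edges matched outside the cut system are the same for all these paths.
  set F := pathMatching K H (splice n (cutLeft K n c) d) \ E' with hF
  have hunion : ∀ w, IsPath (cutLeft K n c) (cutRight H n c) w →
      pathMatching (cutLeft K n c) (cutRight H n c) w ∪ F = pathMatching K H (splice n w d) := by
    intro w hw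
    ext a
    by_cases ha : a ∈ E'
    · rw [mem_pathMatching_splice hd hw ha]
      exact ⟨fun h => h.resolve_right fun h => h.2 ha, Or.inl⟩
    · rw [mem_pathMatching_splice_congr hs hw hK ha]
      exact ⟨fun h => (h.resolve_left fun h => ha h.1).1, fun h => Or.inr ⟨h, ha⟩⟩
  have hlow : ∀ w, IsPath (cutLeft K n c) (cutRight H n c) w →
      e ∈ pathMatching K H (splice n w d) := by
    intro w hw
    refine (he _ (IsPath.splice hd hw)).2 ⟨?_, fun i hi => splice_of_le _ _ hi⟩
    rw [splice_of_lt _ _ (by omega)]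
    refine (hw.le_left _).trans ?_
    rw [cutLeft, splice_of_lt _ _ (by omega)]
    exact min_le_right _ _
  refine finsum_forcing_mem (F := F) ⟨hlow _ hK, heE⟩ ?_ ?_ ?_ ?_ ?_
  · exact fun Y hY => Set.disjoint_left.2 fun a ha haF => haF.2 (hY.1 ha)
  · intro Y hY
    obtain ⟨w, hw, rfl⟩ := exists_path hs' hY
    rw [hunion w hw]
    exact pathMatching_mem hs (IsPath.splice hd hw)
  · intro M hM heM
    obtain ⟨v, hv, rfl⟩ := exists_path hs hM
    obtain ⟨hvc, hvd⟩ := (he v hv).1 heM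
    have hle : ∀ i < n, v i ≤ c := fun i hi => (hv.monotone (by omega)).trans hvc
    have hw : IsPath (cutLeft K n c) (cutRight H n c) (splice n v fun _ => c) := by
      constructor
      · refine monotone_int_of_le_succ fun i => ?_
        have := hv.monotone (show i ≤ i + 1 by omega)
        have := hle i
        simp only [splice]
        split_ifs <;> omega
      · intro i
        have := hv.right_le i
        simp only [cutRight, splice]
        split_ifs <;> omega
      · intro i
        have := hv.le_left i
        have := hle i
        simp only [cutLeft, splice]
        split_ifs <;> omega
    refine ⟨_, pathMatching_mem hs' hw, ?_⟩
    rw [hunion _ hw]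
    congr 1
    ext i
    rcases lt_or_ge i n with hi | hi
    · rw [splice_of_lt _ _ hi, splice_of_lt _ _ hi]
    · rw [splice_of_le _ _ hi, hvd i hi]
  · intro Y hY
    obtain ⟨S, hS⟩ := (hfin'.subset hY.1).exists_finset_coe
    exact ⟨S, hS.le, fun Y' hY' h => systemMatchings_antichain hY hY' (hS ▸ h)⟩
  · intro Y hY
    obtain ⟨w, hw, rfl⟩ := exists_path hs' hY
    refine ⟨_, pathMatching_mem hs (IsPath.splice hd' hw), fun h => ?_, fun a ha => ?_⟩
    · have h1 := hlow w hw
      rw [← hunion w hw, ← h, he _ (IsPath.splice hd' hw)] at h1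
      obtain ⟨i, hi, hdi⟩ := hne
      apply hdi
      rw [← h1.2 i hi, splice_of_le _ _ hi]
    · exact (mem_pathMatching_splice hd' hw ha.1).2 ha

/-! ### The recursion -/

/-- The left ends of the rows of `CHS({k_s; h_s}_{s=1}^m)`, with empty rows `i ≤ 0` and `i > m`. -/
def extendLeft (m : ℕ) (k h : ℕ → ℤ) (i : ℤ) : ℤ :=
  if i ≤ 0 then h 1 - 1 else if i ≤ m then k i.toNat else k m

/-- The right ends of the rows of `CHS({k_s; h_s}_{s=1}^m)`, with empty rows `i ≤ 0` and `i > m`. -/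
def extendRight (m : ℕ) (k h : ℕ → ℤ) (i : ℤ) : ℤ :=
  if i ≤ 0 then h 1 else if i ≤ m then h i.toNat else k m + 1

theorem extendLeft_natCast {m n : ℕ} (k h : ℕ → ℤ) (h1 : 1 ≤ n) (h2 : n ≤ m) :
    extendLeft m k h n = k n := by
  rw [extendLeft, if_neg (by omega), if_pos (by omega), Int.toNat_natCast]

theorem extendRight_natCast {m n : ℕ} (k h : ℕ → ℤ) (h1 : 1 ≤ n) (h2 : n ≤ m) :
    extendRight m k h n = h n := by
  rw [extendRight, if_neg (by omega), if_pos (by omega), Int.toNat_natCast]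

theorem extendLeft_of_gt {m : ℕ} {i : ℤ} (k h : ℕ → ℤ) (hi : m < i) :
    extendLeft m k h i = k m := by
  rw [extendLeft, if_neg (by omega), if_neg (by omega)]

theorem extendRight_of_gt {m : ℕ} {i : ℤ} (k h : ℕ → ℤ) (hi : m < i) :
    extendRight m k h i = k m + 1 := by
  rw [extendRight, if_neg (by omega), if_neg (by omega)]

theorem isRowSystem_extend {m : ℕ} {k h : ℕ → ℤ} (hm : 1 ≤ m)
    (hk : ∀ i : ℕ, 1 ≤ i → i < m → k i ≤ k (i + 1))
    (hh : ∀ i : ℕ, 1 ≤ i → i < m → h i ≤ h (i + 1))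
    (hhk : ∀ j : ℕ, 1 ≤ j → j ≤ m → h j ≤ k j) :
    IsRowSystem (extendLeft m k h) (extendRight m k h) := by
  have hcases : ∀ i : ℤ, i ≤ 0 ∨ (∃ n : ℕ, i = n ∧ 1 ≤ n ∧ n < m) ∨ i = m ∨ m < i := by
    intro i
    rcases le_or_gt i 0 with hi | hi
    · exact Or.inl hi
    · lift i to ℕ using hi.le
      rcases lt_trichotomy i m with h | h | h
      · exact Or.inr (Or.inl ⟨i, rfl, by omega, h⟩)
      · exact Or.inr (Or.inr (Or.inl (by omega)))
      · exact Or.inr (Or.inr (Or.inr (by omega)))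
  have h1 := hhk 1 le_rfl hm
  constructor
  · refine monotone_int_of_le_succ fun i => ?_
    rcases hcases i with hi | ⟨n, rfl, hn, hnm⟩ | rfl | hi
    · rcases eq_or_lt_of_le hi with rfl | hi'
      · have := extendLeft_natCast (m := m) k h le_rfl hm
        rw [Nat.cast_one] at this
        rw [zero_add, this, extendLeft, if_pos le_rfl]
        omega
      · rw [extendLeft, extendLeft, if_pos hi, if_pos (by omega)]
    · have := extendLeft_natCast (m := m) k h (show 1 ≤ n + 1 by omega) hnm
      push_cast at this
      rw [this, extendLeft_natCast k h hn hnm.le]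
      exact hk n hn hnm
    · rw [extendLeft_natCast k h hm le_rfl, extendLeft_of_gt k h (by omega)]
    · rw [extendLeft_of_gt k h hi, extendLeft_of_gt k h (by omega)]
  · refine monotone_int_of_le_succ fun i => ?_
    rcases hcases i with hi | ⟨n, rfl, hn, hnm⟩ | rfl | hi
    · rcases eq_or_lt_of_le hi with rfl | hi'
      · have := extendRight_natCast (m := m) k h le_rfl hm
        rw [Nat.cast_one] at this
        rw [zero_add, this, extendRight, if_pos le_rfl]
      · rw [extendRight, extendRight, if_pos hi, if_pos (by omega)]
    · have := extendRight_natCast (m := m) k h (show 1 ≤ n + 1 by omega) hnm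
      push_cast at this
      rw [this, extendRight_natCast k h hn hnm.le]
      exact hh n hn hnm
    · rw [extendRight_natCast k h hm le_rfl, extendRight_of_gt k h (by omega)]
      have := hhk m hm le_rfl
      omega
    · rw [extendRight_of_gt k h hi, extendRight_of_gt k h (by omega)]
  · intro i
    rcases hcases i with hi | ⟨n, rfl, hn, hnm⟩ | rfl | hi
    · rw [extendRight, extendLeft, if_pos hi, if_pos hi]
      omega
    · rw [extendLeft_natCast k h hn hnm.le, extendRight_natCast k h hn hnm.le]
      have := hhk n hn hnm.le
      omega
    · rw [extendLeft_natCast k h hm le_rfl, extendRight_natCast k h hm le_rfl]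
      have := hhk m hm le_rfl
      omega
    · rw [extendLeft_of_gt k h hi, extendRight_of_gt k h hi]
  · intro i hi
    rw [extendRight, extendLeft, if_pos hi, if_pos hi]
    omega

theorem isRowExtension_extend (m : ℕ) (k h : ℕ → ℤ) :
    IsRowExtension m k h (extendLeft m k h) (extendRight m k h) := by
  intro i j
  constructor
  · intro hij
    by_cases h1 : i ≤ 0
    · rw [extendRight, extendLeft, if_pos h1, if_pos h1] at hij
      omega
    by_cases h2 : i ≤ m
    · lift i to ℕ using (by omega)
      rw [extendLeft_natCast k h (by omega) (by omega),
        extendRight_natCast k h (by omega) (by omega)] at hij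
      exact ⟨i, rfl, by omega, by omega, hij⟩
    · rw [extendLeft_of_gt k h (by omega), extendRight_of_gt k h (by omega)] at hij
      omega
  · rintro ⟨n, rfl, h1, h2, h3⟩
    rwa [extendLeft_natCast k h h1 h2, extendRight_natCast k h h1 h2]

theorem isRowExtension_cut {m n : ℕ} (k h : ℕ → ℤ) (hnm : n ≤ m) (c : ℤ) :
    IsRowExtension (n - 1) (fun s => min (k s) c) h (cutLeft (extendLeft m k h) n c)
      (cutRight (extendRight m k h) n c) := by
  intro i j
  have key := isRowExtension_extend m k h i j
  rcases lt_or_ge i n with hi | hi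
  · rw [cutLeft, cutRight, splice_of_lt _ _ hi, splice_of_lt _ _ hi, le_min_iff, ← and_assoc, key]
    constructor
    · rintro ⟨⟨s, rfl, h1, h2, h3, h4⟩, h5⟩
      exact ⟨s, rfl, h1, by omega, h3, le_min h4 h5⟩
    · rintro ⟨s, rfl, h1, h2, h3, h4⟩
      rw [le_min_iff] at h4
      exact ⟨⟨s, rfl, h1, by omega, h3, h4.1⟩, h4.2⟩
  · rw [cutLeft, cutRight, splice_of_le _ _ hi, splice_of_le _ _ hi]
    constructor
    · intro h
      omega
    · rintro ⟨s, rfl, h1, h2, -⟩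
      omega

theorem chsForcingPoly_recursion {m : ℕ} {k h : ℕ → ℤ} (hm : 1 ≤ m)
    (hk : ∀ i : ℕ, 1 ≤ i → i < m → k i ≤ k (i + 1))
    (hh : ∀ i : ℕ, 1 ≤ i → i < m → h i ≤ h (i + 1))
    (hhk : ∀ j : ℕ, 1 ≤ j → j ≤ m → h j ≤ k j)
    {p : ℕ} (hp : IsLeast {s : ℕ | 1 ≤ s ∧ s ≤ m ∧ k s = k m} p) :
    chsForcingPoly m k h =
      (∑ i ∈ Finset.Icc (h m - 1) (k m - 1),
        chsForcingPoly (m - 1) (fun s => min (k s) i) h * X) +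
      ∑ j ∈ Finset.Icc p m,
        chsForcingPoly (j - 1) (fun s => min (k s) (k m - 1)) h * X := by
  have hs := isRowSystem_extend hm hk hh hhk
  have hext := isRowExtension_extend m k h
  have hcut := fun (n : ℕ) (hn : n ≤ m) c => chsForcingPoly_eq_system (isRowExtension_cut k h hn c)
  have hKm := extendLeft_natCast k h hm le_rfl
  have hHm := extendRight_natCast k h hm le_rfl
  have hKgt := fun i hi => extendLeft_of_gt (m := m) (i := i) k h hi
  have hHgt := fun i hi => extendRight_of_gt (m := m) (i := i) k h hi
  have hKnat := fun n h1 h2 => extendLeft_natCast (m := m) (n := n) k h h1 h2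
  have hempty : ∀ i ≤ 0, extendLeft m k h i < k m := by
    intro i hi
    have h1 := hs.empty i hi
    have h2 := hs.monotone_right (show i ≤ m by omega)
    have := hhk m hm le_rfl
    omega
  have hfin := finite_systemEdges hext
  rw [chsForcingPoly_eq_system hext]
  generalize extendLeft m k h = K at *
  generalize extendRight m k h = H at *
  have hfinM := finite_systemMatchings hfin
  have hhkm := hhk m hm le_rfl
  have hKle : ∀ i, K i ≤ k m := by
    intro i
    rcases le_or_gt i m with hi | hi
    · exact hKm ▸ hs.monotone_left hi
    · rw [hKgt i hi]
  have hHle : ∀ i ≤ (m : ℤ), H i ≤ h m := fun i hi => hHm ▸ hs.monotone_right hi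
  have hlast : ∀ v, IsPath K H v → ∀ i : ℤ, m < i → v i = k m := by
    intro v hv i hi
    have h1 := hv.right_le i
    have h2 := hv.le_left i
    rw [hHgt i hi] at h1
    rw [hKgt i hi] at h2
    omega
  have hpK : ∀ j : ℕ, p ≤ j → ∀ i : ℤ, j ≤ i → K i = k m := by
    intro j hj i hi
    refine le_antisymm (hKle i) ?_
    rw [← hp.1.2.2, ← hKnat p hp.1.1 hp.1.2.1]
    exact hs.monotone_left (by omega)
  have hvert : ∀ i ∈ Finset.Icc (h m - 1) (k m - 1),
      ∑ᶠ M ∈ {M ∈ systemMatchings K H | .vert m i ∈ M},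
        (X : ℤ[X]) ^ familyForcingNumber (systemMatchings K H) M =
      chsForcingPoly (m - 1) (fun s => min (k s) i) h * X := by
    intro i hi
    rw [Finset.mem_Icc] at hi
    rw [hcut m le_rfl i]
    -- Moving the crossing of row `m` one step to the left flips the hexagon `C m (i+1)`.
    refine finsum_forcing_cut hs hfin (by omega) ?_
      (d := splice (m + 1) (fun _ => i) fun _ => k m)
      (d' := splice (m + 1) (fun _ => i + 1) fun _ => k m) ?_ ?_ ⟨m, le_rfl, ?_⟩ ?_ ?_
    · intro r hr
      have := hHle r hr.le
      omega
    · constructor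
      · intro r hr
        simp only [splice]
        split_ifs <;> omega
      · intro r hr
        simp only [splice]
        split_ifs <;> omega
      · intro r hr
        have := hHgt r
        have := hHle r
        simp only [splice]
        split_ifs <;> omega
      · intro r hr
        have := hKgt r
        have := hs.monotone_left hr
        simp only [splice]
        split_ifs <;> omega
    · constructor
      · intro r hr
        simp only [splice]
        split_ifs <;> omega
      · intro r hr
        simp only [splice]
        split_ifs <;> omega
      · intro r hr
        have := hHgt r
        have := hHle r
        simp only [splice]
        split_ifs <;> omega
      · intro r hr
        have := hKgt r
        have := hs.monotone_left hr
        simp only [splice]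
        split_ifs <;> omega
    · rw [splice_of_lt _ _ (by omega), splice_of_lt _ _ (by omega)]
      omega
    · rw [vert_mem_systemEdges, cutLeft, cutRight, splice_of_le _ _ le_rfl, splice_of_le _ _ le_rfl]
      omega
    · intro v hv
      rw [vert_mem_pathMatching, vert_mem_systemEdges, hKm, hHm]
      constructor
      · rintro ⟨-, hvi⟩
        refine ⟨hvi ▸ hv.monotone (by omega), fun r hr => ?_⟩
        rcases eq_or_lt_of_le hr with rfl | hr'
        · rw [splice_of_lt _ _ (by omega), hvi]
        · rw [splice_of_le _ _ (by omega), hlast v hv r hr']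
      · rintro ⟨-, hv'⟩
        refine ⟨by omega, ?_⟩
        rw [hv' m le_rfl, splice_of_lt _ _ (by omega)]
  have hright : ∀ j ∈ Finset.Icc p m,
      ∑ᶠ M ∈ {M ∈ systemMatchings K H | .right j (k m) ∈ M},
        (X : ℤ[X]) ^ familyForcingNumber (systemMatchings K H) M =
      chsForcingPoly (j - 1) (fun s => min (k s) (k m - 1)) h * X := by
    intro j hj
    rw [Finset.mem_Icc] at hj
    have hp1 := hp.1.1
    rw [hcut j hj.2 (k m - 1)]
    -- Moving the crossing of row `j` one step to the right flips the hexagon `C j (k m)`.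
    refine finsum_forcing_cut hs hfin (by omega) ?_
      (d := fun _ => k m)
      (d' := splice (j + 1) (fun _ => k m - 1) fun _ => k m) ?_ ?_ ⟨j, le_rfl, ?_⟩ ?_ ?_
    · intro r hr
      have := hHle r (by omega)
      omega
    · constructor
      · intro r hr
        exact le_rfl
      · intro r hr
        omega
      · intro r hr
        have := hHgt r
        have := hHle r
        omega
      · intro r hr
        rw [hpK j hj.1 r hr]
    · constructor
      · intro r hr
        simp only [splice]
        split_ifs <;> omega
      · intro r hr
        simp only [splice]
        split_ifs <;> omega
      · intro r hr
        have := hHgt r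
        have := hHle r
        simp only [splice]
        split_ifs <;> omega
      · intro r hr
        rw [hpK j hj.1 r hr]
        simp only [splice]
        split_ifs <;> omega
    · rw [splice_of_lt _ _ (by omega)]
      omega
    · rw [right_mem_systemEdges]
      simp only [cutLeft, cutRight, splice]
      split_ifs <;> omega
    · intro v hv
      have hH := hHle j (by omega)
      have hK := hpK j hj.1 j le_rfl
      rw [right_mem_pathMatching, right_mem_systemEdges]
      constructor
      · rintro ⟨-, h1, h2⟩
        refine ⟨by omega, fun r hr => ?_⟩
        have := hv.le_left r
        have := hKle r
        have := hv.monotone hr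
        omega
      · rintro ⟨h1, h2⟩
        have := h2 j le_rfl
        omega
  -- Classification of the matchings by the crossing of row `m` and by the first crossing at `k m`.
  have hunion : systemMatchings K H =
      (⋃ i ∈ (Finset.Icc (h m - 1) (k m - 1) : Set ℤ),
        {M ∈ systemMatchings K H | .vert m i ∈ M}) ∪
      ⋃ j ∈ (Finset.Icc p m : Set ℕ), {M ∈ systemMatchings K H | .right j (k m) ∈ M} := by
    refine Set.Subset.antisymm (fun M hM => ?_) (Set.union_subset ?_ ?_)
    · obtain ⟨v, hv, rfl⟩ := exists_path hs hM
      have h1 := hv.right_le m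
      have h2 := hv.le_left m
      rw [hHm] at h1
      rw [hKm] at h2
      rcases eq_or_lt_of_le h2 with hvm | hvm
      · right
        have hex : ∃ s : ℕ, v s = k m := ⟨m, hvm⟩
        classical
        have hspec := Nat.find_spec hex
        have hmin := fun s => Nat.find_min (m := s) hex
        have hle := Nat.find_min' hex hvm
        generalize Nat.find hex = j at *
        have hvK := hv.le_left j
        have hj1 : 1 ≤ j := by
          by_contra hj0
          have := hempty j (by omega)
          omega
        have hKj := hKle j
        have hpj : p ≤ j := by
          refine hp.2 ⟨hj1, hle, ?_⟩
          rw [← hKnat j hj1 hle]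
          omega
        simp only [Set.mem_iUnion]
        refine ⟨j, by simpa using ⟨hpj, hle⟩, hM, ?_⟩
        rw [right_mem_pathMatching, right_mem_systemEdges]
        have hH := hHle j (by omega)
        have hprev := hmin (j - 1) (by omega)
        rw [show ((j - 1 : ℕ) : ℤ) = (j : ℤ) - 1 by omega] at hprev
        have := hv.monotone (show (j : ℤ) - 1 ≤ j by omega)
        omega
      · left
        simp only [Set.mem_iUnion]
        refine ⟨v m, by simp; omega, hM, ?_⟩
        rw [vert_mem_pathMatching, vert_mem_systemEdges, hHm, hKm]
        omega
    · simp only [Set.iUnion_subset_iff]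
      exact fun i hi M hM => hM.1
    · simp only [Set.iUnion_subset_iff]
      exact fun i hi M hM => hM.1
  have hvert_eq : ∀ {v : ℤ → ℤ} {i : ℤ}, .vert m i ∈ pathMatching K H v → v m = i :=
    fun hM => hM.2
  have hdisjL : (Finset.Icc (h m - 1) (k m - 1) : Set ℤ).PairwiseDisjoint
      fun i => {M ∈ systemMatchings K H | .vert m i ∈ M} := by
    intro i _ i' _ hne
    refine Set.disjoint_left.2 fun M hM hM' => hne ?_
    obtain ⟨v, hv, rfl⟩ := exists_path hs hM.1
    exact (hvert_eq hM.2).symm.trans (hvert_eq hM'.2)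
  have hdisjR : (Finset.Icc p m : Set ℕ).PairwiseDisjoint
      fun j : ℕ => {M ∈ systemMatchings K H | .right j (k m) ∈ M} := by
    intro j _ j' _ hne
    refine Set.disjoint_left.2 fun M hM hM' => hne ?_
    obtain ⟨v, hv, rfl⟩ := exists_path hs hM.1
    have h1 := (right_mem_pathMatching.1 hM.2).2
    have h2 := (right_mem_pathMatching.1 hM'.2).2
    rcases lt_trichotomy j j' with hlt | heq | hgt
    · have := hv.monotone (show (j : ℤ) ≤ (j' : ℤ) - 1 by omega)
      omega
    · exact heq
    · have := hv.monotone (show (j' : ℤ) ≤ (j : ℤ) - 1 by omega)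
      omega
  have hsplit : ∑ᶠ M ∈ systemMatchings K H,
      (X : ℤ[X]) ^ familyForcingNumber (systemMatchings K H) M = _ :=
    finsum_mem_congr hunion fun _ _ => rfl
  rw [familyForcingPoly, hsplit, finsum_mem_union ?_
      ((Finset.finite_toSet _).biUnion fun i _ => hfinM.subset fun M hM => hM.1)
      ((Finset.finite_toSet _).biUnion fun i _ => hfinM.subset fun M hM => hM.1),
    finsum_mem_biUnion hdisjL (Finset.finite_toSet _) fun i _ => hfinM.subset fun M hM => hM.1,
    finsum_mem_biUnion hdisjR (Finset.finite_toSet _) fun i _ => hfinM.subset fun M hM => hM.1,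
    finsum_mem_coe_finset, finsum_mem_coe_finset, Finset.sum_congr rfl hvert,
    Finset.sum_congr rfl hright]
  refine Set.disjoint_left.2 fun M hM hM' => ?_
  simp only [Set.mem_iUnion] at hM hM'
  obtain ⟨i, hi, hMS, hMi⟩ := hM
  obtain ⟨j, hj, -, hMj⟩ := hM'
  rw [Finset.mem_coe, Finset.mem_Icc] at hi hj
  obtain ⟨v, hv, rfl⟩ := exists_path hs hMS
  have h1 := hvert_eq hMi
  have h2 := (right_mem_pathMatching.1 hMj).2
  have := hv.monotone (show (j : ℤ) ≤ m by omega)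
  omega

theorem chsEdges_of_empty_row {m : ℕ} {k h : ℕ → ℤ} (hm : k m < h m) :
    chsEdges m k h = chsEdges (m - 1) k h := by
  ext e
  constructor
  · rintro ⟨i, j, h1, h2, h3, h4, he⟩
    refine ⟨i, j, h1, ?_, h3, h4, he⟩
    have : i ≠ m := by
      rintro rfl
      omega
    omega
  · rintro ⟨i, j, h1, h2, h3⟩
    exact ⟨i, j, h1, by omega, h3⟩

theorem chsForcingPoly_zero (k h : ℕ → ℤ) : chsForcingPoly 0 k h = 1 := by
  have hE : chsEdges 0 k h = ∅ := by
    ext e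
    simp only [Set.mem_empty_iff_false, iff_false]
    rintro ⟨i, j, h1, h2, -⟩
    omega
  have hM : perfectMatchings (chsEdges 0 k h) = {∅} := by
    rw [hE]
    ext Y
    simp only [perfectMatchings, Set.subset_empty_iff, Set.mem_singleton_iff]
    exact ⟨fun hY => hY.1, fun hY => ⟨hY, fun e he => absurd he (Set.notMem_empty e)⟩⟩
  have h0 : familyForcingNumber ({∅} : Set (Set (Sym2 HexVertex))) ∅ = 0 :=
    Nat.le_zero.1 (Nat.sInf_le ⟨∅, by simp⟩)
  rw [chsForcingPoly_eq_family, hM, familyForcingPoly, finsum_mem_singleton, h0, pow_zero]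

theorem theorem3p2 :
    (∀ (m : ℕ) (k h : ℕ → ℤ), 1 ≤ m →
      (∀ i : ℕ, 1 ≤ i → i < m → k i ≤ k (i + 1)) →
      (∀ i : ℕ, 1 ≤ i → i < m → h i ≤ h (i + 1)) →
      (∀ j : ℕ, 1 ≤ j → j ≤ m → h j ≤ k j) →
      ∀ p : ℕ, IsLeast {s : ℕ | 1 ≤ s ∧ s ≤ m ∧ k s = k m} p →
        chsForcingPoly m k h =
          (∑ i ∈ Finset.Icc (h m - 1) (k m - 1),
            chsForcingPoly (m - 1) (fun s => min (k s) i) h * Polynomial.X) +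
          ∑ j ∈ Finset.Icc p m,
            chsForcingPoly (j - 1) (fun s => min (k s) (k m - 1)) h * Polynomial.X) ∧
    (∀ (i : ℕ) (b d : ℕ → ℤ), 1 ≤ i → b i < d i →
      chsForcingPoly i b d = chsForcingPoly (i - 1) b d) ∧
    (∀ b d : ℕ → ℤ, chsForcingPoly 0 b d = 1) := by
  refine ⟨fun m k h hm hk hh hhk p hp => chsForcingPoly_recursion hm hk hh hhk hp,
    fun i b d _ hbd => ?_, chsForcingPoly_zero⟩
  rw [chsForcingPoly_eq_family, chsForcingPoly_eq_family, chsEdges_of_empty_row hbd]
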